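/- Let $r,s>0$ satisfy $\frac1r+\frac1s<1$, and define, for $x\in\mathbb{R}$, $$\phi_{r,s}(x)=\begin{cases}|x|^{\,2-r\left(\frac3r+\frac1s-1\right)} & \text{if } \frac3r+\frac1s>1,\\[2pt] |x|^2\log\!\left(1+\frac1{|x|}\right) & \text{if } \frac3r+\frac1s=1,\\[2pt] |x|^2 & \text{if } \frac3r+\frac1s<1,\end{cases}$$ with $\phi_{r,s}(0)=0$. Let $\phi_{s,r}$ be the function obtained by exchanging the roles of $r$ and $s$. Let $g\in L^2(\mathbb{R})$ have Fourier transform $\hat g$ (where $\hat g(\xi)=\int_{\mathbb{R}} g(t)e^{-2\pi i \xi t}\,dt$, extended to $L^2(\mathbb{R})$), and suppose that $$\int_{\mathbb{R}}|\xi|^r|\hat g(\xi)|^2\,d\xi<\infty\qquad\text{and}\qquad\int_{\mathbb{R}}|t|^s|g(t)|^2\,dt<\infty .$$ Then $g$ agrees almost everywhere with a (unique) continuous function, again denoted by $g$; its Zak transform $$Zg(x,y)=\sum_{k\in\mathbb{Z}}g(x-k)e^{2\pi i k y}$$ converges absolutely at every $(x,y)\in\mathbb{R}^2$ and is continuous on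 $\mathbb{R}^2$; and for every $(a,b)\in\mathbb{R}^2$ there is a constant $C>0$, not depending on $x$ and $y$, such that $$|Zg(x,y)-Zg(a,b)|^2\le C\big(\phi_{r,s}(x-a)+\phi_{s,r}(y-b)\big)\qquad\text{for all }(x,y)\in\mathbb{R}^2 .$$ -/

import Mathlib

open MeasureTheory
open scoped FourierTransform

/-- The Zak transform `Zg(x,y) = ∑_{k ∈ ℤ} g(x - k) e^{2πiky}`. -/
noncomputable def zak (g : ℝ → ℂ) (x y : ℝ) : ℂ :=
  ∑' k : ℤ, g (x - k) * Complex.exp (2 * Real.pi * Complex.I * k * y)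

/-- The modulus `φ_{r,s}`. -/
noncomputable def zakModulus (r s x : ℝ) : ℝ :=
  if 1 < 3 / r + 1 / s then |x| ^ (2 - r * (3 / r + 1 / s - 1))
  else if 3 / r + 1 / s = 1 then |x| ^ 2 * Real.log (1 + 1 / |x|)
  else |x| ^ 2

/-! Zak increments are sums over `ℤ` of values of `g`, or of its Fourier transform, times
differences of characters, so everything rests on a summable majorant of local suprema with
controlled tails.

The majorant comes from the Gaussian short-time Fourier transform `V(u, ξ)`. Plancherel in `ξ`
bounds `V` in `L²` with weight `(1+|u|)^s`; rotating the time-frequency plane gives the weight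
`(1+|ξ|)^r`. Put `N(u) = ∫ |V(u, ξ)| dξ`. Inversion gives `|f(x)| ≤ e^{π(x-u)²} N(u)`, and
Cauchy–Schwarz in `ξ` gives `∫ (1+|u|)^σ N² < ∞` with `σ = s(1 - 1/r)` (`exists_local_majorant`).
The hypothesis `1/r + 1/s < 1` says exactly that `σ > 1`, so integrals of `N` over unit intervals
are summable.

For fixed `x`, moving `y` by `h` changes the `n`-th character by at most a multiple of `min(1,
|h|(1+|n|))`. A second Cauchy–Schwarz bounds the squared increment by `∫ (1+|u|)^{-σ} min(1,
|h|(1+|u|))² du`, which is of order `φ_{s,r}(h)`; the three cases are `σ < 3`, `σ = 3`, `σ > 3`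
(`exists_summable_majorant`). Poisson summation exchanges the variables, and the same bound for the
Fourier transform, with `r` and `s` swapped, handles increments in `x`. -/

/-! ### Fourier transform on `L¹ ∩ L²` -/

theorem Real.integral_fourier_mul {f g : ℝ → ℂ} (hf : Integrable f) (hg : Integrable g) :
    ∫ ξ, 𝓕 f ξ * g ξ = ∫ x, f x * 𝓕 g x := by
  have := VectorFourier.integral_bilin_fourierIntegral_eq_flip (ContinuousLinearMap.mul ℂ ℂ)
    (L := innerₗ ℝ) (μ := volume) (ν := volume) Real.continuous_fourierChar
    continuous_inner hf hg
  simpa using! this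

theorem Real.integral_fourierInv_mul {f g : ℝ → ℂ} (hf : Integrable f) (hg : Integrable g) :
    ∫ ξ, 𝓕⁻ f ξ * g ξ = ∫ x, f x * 𝓕⁻ g x := by
  have h1 : ∫ ξ, 𝓕⁻ f ξ * g ξ = ∫ ξ, 𝓕 f ξ * g (-ξ) := by
    rw [← integral_neg_eq_self]
    simp [Real.fourierInv_eq_fourier_neg]
  rw [h1, Real.integral_fourier_mul hf hg.comp_neg, Real.fourierInv_eq_fourier_comp_neg]

theorem Real.continuous_fourier {f : ℝ → ℂ} (hf : Integrable f) : Continuous (𝓕 f) :=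
  VectorFourier.fourierIntegral_continuous Real.continuous_fourierChar
      continuous_inner hf

theorem Real.continuous_fourierInv {f : ℝ → ℂ} (hf : Integrable f) : Continuous (𝓕⁻ f) := by
  rw [Real.fourierInv_eq_fourier_comp_neg]
  exact Real.continuous_fourier hf.comp_neg

/-- On `L¹ ∩ L²` the `L²` Fourier transform is given by the integral formula. -/
theorem MeasureTheory.Lp.coeFn_fourier_of_integrable (g : Lp ℂ 2 (volume : Measure ℝ))
    (hg : Integrable g) :
    (𝓕 g : Lp ℂ 2 (volume : Measure ℝ)) =ᵐ[volume] 𝓕 (g : ℝ → ℂ) := by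
  -- Both sides are tested against smooth compactly supported functions: the `L²` transform moves
  -- onto the test function as for tempered distributions, and integrability of `g` lets it move
  -- back.
  refine ae_eq_of_integral_contDiff_smul_eq ((Lp.memLp _).locallyIntegrable (by norm_num))
    (Real.continuous_fourier hg).locallyIntegrable fun φ hφ hφc ↦ ?_
  have hg₁ : HasCompactSupport (Complex.ofRealCLM ∘ φ) := hφc.comp_left rfl
  have hg₂ : ContDiff ℝ (⊤ : ℕ∞) (Complex.ofRealCLM ∘ φ) := by fun_prop
  let ψ := hg₁.toSchwartzMap hg₂
  have hψ : ∀ x, ψ x = φ x := fun x ↦ rfl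
  calc ∫ x, φ x • (𝓕 g : Lp ℂ 2 (volume : Measure ℝ)) x
      = Lp.toTemperedDistribution (𝓕 g : Lp ℂ 2 (volume : Measure ℝ)) ψ := by simp [hψ]
    _ = ∫ x, 𝓕 (ψ : ℝ → ℂ) x * g x := by
        rw [← Lp.fourier_toTemperedDistribution_eq, TemperedDistribution.fourier_apply,
          Lp.toTemperedDistribution_apply]
        simp [SchwartzMap.fourier_coe]
    _ = ∫ x, φ x • 𝓕 (g : ℝ → ℂ) x := by
        rw [Real.integral_fourier_mul ψ.integrable hg]
        simp [hψ]

theorem MeasureTheory.Lp.coeFn_fourierInv_of_integrable (g : Lp ℂ 2 (volume : Measure ℝ))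
    (hg : Integrable g) :
    (𝓕⁻ g : Lp ℂ 2 (volume : Measure ℝ)) =ᵐ[volume] 𝓕⁻ (g : ℝ → ℂ) := by
  refine ae_eq_of_integral_contDiff_smul_eq ((Lp.memLp _).locallyIntegrable (by norm_num))
    (Real.continuous_fourierInv hg).locallyIntegrable fun φ hφ hφc ↦ ?_
  have hg₁ : HasCompactSupport (Complex.ofRealCLM ∘ φ) := hφc.comp_left rfl
  have hg₂ : ContDiff ℝ (⊤ : ℕ∞) (Complex.ofRealCLM ∘ φ) := by fun_prop
  let ψ := hg₁.toSchwartzMap hg₂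
  have hψ : ∀ x, ψ x = φ x := fun x ↦ rfl
  calc ∫ x, φ x • (𝓕⁻ g : Lp ℂ 2 (volume : Measure ℝ)) x
      = Lp.toTemperedDistribution (𝓕⁻ g : Lp ℂ 2 (volume : Measure ℝ)) ψ := by simp [hψ]
    _ = ∫ x, 𝓕⁻ (ψ : ℝ → ℂ) x * g x := by
        rw [← Lp.fourierInv_toTemperedDistribution_eq, TemperedDistribution.fourierInv_apply,
          Lp.toTemperedDistribution_apply]
        simp [SchwartzMap.fourierInv_coe]
    _ = ∫ x, φ x • 𝓕⁻ (g : ℝ → ℂ) x := by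
        rw [Real.integral_fourierInv_mul ψ.integrable hg]
        simp [hψ]

/-- Plancherel's theorem on `L¹ ∩ L²`. -/
theorem Real.lintegral_enorm_fourier_sq {f : ℝ → ℂ} (hf : Integrable f) (hf2 : MemLp f 2) :
    ∫⁻ ξ, ‖𝓕 f ξ‖ₑ ^ 2 = ∫⁻ x, ‖f x‖ₑ ^ 2 := by
  have key (F : Lp ℂ 2 (volume : Measure ℝ)) : ∫⁻ x, ‖F x‖ₑ ^ 2 = ‖F‖ₑ ^ 2 := by
    rw [Lp.enorm_def, eLpNorm_eq_lintegral_rpow_enorm_toReal (by norm_num) (by norm_num),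
      ← ENNReal.rpow_natCast, ← ENNReal.rpow_mul]
    simp
  have h1 := hf2.coeFn_toLp
  have hi : Integrable (hf2.toLp f) := hf.congr h1.symm
  have h2 := Lp.coeFn_fourier_of_integrable _ hi
  calc ∫⁻ ξ, ‖𝓕 f ξ‖ₑ ^ 2
      = ∫⁻ ξ, ‖(𝓕 (hf2.toLp f) : Lp ℂ 2 (volume : Measure ℝ)) ξ‖ₑ ^ 2 := by
        refine lintegral_congr_ae ?_
        filter_upwards [h2] with x hx
        rw [hx, Real.fourier_congr_ae h1]
    _ = ∫⁻ ξ, ‖hf2.toLp f ξ‖ₑ ^ 2 := by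
        rw [key, key]
        congr 1
        rw [← ofReal_norm, ← ofReal_norm, Lp.norm_fourier_eq]
    _ = _ := by
        refine lintegral_congr_ae ?_
        filter_upwards [h1] with x hx
        rw [hx]

/-! ### Gaussian short-time Fourier transform -/

/-- The short-time Fourier transform with Gaussian window. -/
noncomputable def gaussSTFT (f : ℝ → ℂ) (u ξ : ℝ) : ℂ :=
  𝓕 (fun t : ℝ => f t * (Real.exp (-Real.pi * (t - u) ^ 2) : ℂ)) ξ

theorem norm_gaussian_le_one (x : ℝ) : ‖(Real.exp (-Real.pi * x ^ 2) : ℂ)‖ ≤ 1 := by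
  rw [Complex.norm_real, Real.norm_eq_abs, Real.abs_exp, Real.exp_le_one_iff]
  nlinarith [sq_nonneg x, Real.pi_pos]

theorem integrable_mul_gaussian {f : ℝ → ℂ} (hf : Integrable f) (u : ℝ) :
    Integrable fun t : ℝ => f t * (Real.exp (-Real.pi * (t - u) ^ 2) : ℂ) :=
  hf.mul_bdd (c := 1) (by fun_prop) (Filter.Eventually.of_forall fun t ↦ norm_gaussian_le_one _)

theorem memLp_mul_gaussian {f : ℝ → ℂ} (hf : MemLp f 2) (u : ℝ) :
    MemLp (fun t : ℝ => f t * (Real.exp (-Real.pi * (t - u) ^ 2) : ℂ)) 2 := by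
  refine hf.of_le (hf.1.mul (by fun_prop)) (Filter.Eventually.of_forall fun t ↦ ?_)
  rw [norm_mul]
  exact mul_le_of_le_one_right (norm_nonneg _) (norm_gaussian_le_one _)

theorem measurable_gaussSTFT {f : ℝ → ℂ} (hf : Continuous f) :
    Measurable (Function.uncurry (gaussSTFT f)) := by
  have : StronglyMeasurable fun q : (ℝ × ℝ) × ℝ =>
      Real.fourierChar (-(q.2 * q.1.2)) • (f q.2 * (Real.exp (-Real.pi * (q.2 - q.1.1) ^ 2) : ℂ)) := by
    refine Continuous.stronglyMeasurable ?_
    simp only [Circle.smul_def, smul_eq_mul]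
    fun_prop
  have h := this.integral_prod_right' (ν := volume)
  convert h.measurable using 1
  ext p
  simp only [Function.uncurry, gaussSTFT, Real.fourier_real_eq]

/-- The short-time Fourier transforms of `f` and of `𝓕 f` agree up to a rotation of the
time-frequency plane. -/
theorem norm_gaussSTFT_eq {f : ℝ → ℂ} (hf : Integrable f) (u ξ : ℝ) :
    ‖gaussSTFT f u ξ‖ = ‖gaussSTFT (𝓕 f) ξ (-u)‖ := by
  -- With this `c`, `E * 𝓕 γ` is the Gaussian at `u` modulated by `-ξ`, while `E * γ` is, up to a
  -- unimodular constant, the Gaussian at `ξ` modulated by `u`. The multiplication formula then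
  -- links the two transforms.
  set c : ℂ := ξ + Complex.I * u with hc
  set E : ℂ := Complex.exp (-Real.pi * ξ ^ 2 - 2 * Real.pi * Complex.I * u * ξ) with hE
  set γ : ℝ → ℂ := fun x => Complex.exp (-Real.pi * 1 * x ^ 2 + 2 * Real.pi * c * x) with hγ
  have hγi : Integrable γ := by
    have := integrable_cexp_quadratic (b := Real.pi) (by simpa using Real.pi_pos)
      (2 * Real.pi * c) 0
    simpa [hγ] using this
  have hFγ : 𝓕 γ = fun t : ℝ => Complex.exp (-Real.pi * (t + Complex.I * c) ^ 2) := by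
    rw [hγ, fourier_gaussian_pi' (by simp)]
    simp
  have h1 : gaussSTFT f u ξ = E * ∫ t, f t * 𝓕 γ t := by
    rw [gaussSTFT, Real.fourier_real_eq_integral_exp_smul, ← integral_const_mul, hFγ]
    refine integral_congr_ae (Filter.Eventually.of_forall fun t ↦ ?_)
    simp only [smul_eq_mul, hE, hc]
    rw [mul_left_comm, mul_left_comm E, Complex.ofReal_exp, ← Complex.exp_add, hE, ← Complex.exp_add]
    congr 2
    push_cast
    ring_nf
    simp only [Complex.I_sq, Complex.I_pow_three, Complex.I_pow_four]
    ring
  have h2 : gaussSTFT (𝓕 f) ξ (-u) =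
      Complex.exp (((2 * Real.pi * u * ξ : ℝ) : ℂ) * Complex.I) * (E * ∫ t, 𝓕 f t * γ t) := by
    rw [gaussSTFT, Real.fourier_real_eq_integral_exp_smul, ← integral_const_mul,
      ← integral_const_mul]
    refine integral_congr_ae (Filter.Eventually.of_forall fun t ↦ ?_)
    have key : Complex.exp (↑(-2 * Real.pi * t * -u) * Complex.I) *
        (Real.exp (-Real.pi * (t - ξ) ^ 2) : ℂ) =
        Complex.exp (((2 * Real.pi * u * ξ : ℝ) : ℂ) * Complex.I) * (E * γ t) := by
      simp only [hE, hγ, hc]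
      rw [Complex.ofReal_exp, ← Complex.exp_add, ← Complex.exp_add, ← Complex.exp_add]
      congr 1
      push_cast
      ring_nf
    simp only [smul_eq_mul]
    linear_combination 𝓕 f t * key
  rw [h1, h2, norm_mul (Complex.exp (((2 * Real.pi * u * ξ : ℝ) : ℂ) * Complex.I)), 
    Complex.norm_exp_ofReal_mul_I, one_mul, Real.integral_fourier_mul hf hγi]

/-- Fourier inversion for the windowed function, divided by the value of the window at `x`. The
centre `u` is free, which later permits averaging over it. -/
theorem enorm_le_lintegral_gaussSTFT {f : ℝ → ℂ} (hfc : Continuous f) (hf : Integrable f)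
    (x u : ℝ) : ‖f x‖ₑ ≤ ENNReal.ofReal (Real.exp (Real.pi * (x - u) ^ 2)) *
      ∫⁻ ξ, ‖gaussSTFT f u ξ‖ₑ := by
  set h : ℝ → ℂ := fun t : ℝ => f t * (Real.exp (-Real.pi * (t - u) ^ 2) : ℂ) with hh
  have hi := integrable_mul_gaussian hf u
  have hc : Continuous h := by fun_prop
  by_cases hN : ∫⁻ ξ, ‖gaussSTFT f u ξ‖ₑ = ⊤
  · rw [hN, ENNReal.mul_top (by simp [Real.exp_pos])]
    exact le_top
  have hFi : Integrable (𝓕 h) :=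
    ⟨(Real.continuous_fourier hi).aestronglyMeasurable, lt_top_iff_ne_top.2 hN⟩
  have hx : ‖h x‖ₑ ≤ ∫⁻ ξ, ‖gaussSTFT f u ξ‖ₑ := by
    rw [← hc.fourierInv_fourier_eq hi hFi, Real.fourierInv_eq]
    refine (enorm_integral_le_lintegral_enorm _).trans (le_of_eq ?_)
    refine lintegral_congr fun ξ ↦ ?_
    rw [← ofReal_norm, ← ofReal_norm, Circle.norm_smul]
    rfl
  calc ‖f x‖ₑ = ENNReal.ofReal (Real.exp (Real.pi * (x - u) ^ 2)) * ‖h x‖ₑ := by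
        rw [← ofReal_norm, ← ofReal_norm, ← ENNReal.ofReal_mul (Real.exp_pos _).le, hh, norm_mul,
          Complex.norm_real, Real.norm_eq_abs, Real.abs_exp, mul_left_comm, ← Real.exp_add]
        simp
    _ ≤ _ := by gcongr

theorem one_add_abs_rpow_mul_exp_le {s : ℝ} (hs : 0 ≤ s) (v : ℝ) :
    (1 + |v|) ^ s * Real.exp (-(2 * Real.pi) * v ^ 2) ≤
      Real.exp (s ^ 2) * Real.exp (-Real.pi * v ^ 2) := by
  have h1 : (1 + |v|) ^ s ≤ Real.exp (s * |v|) := by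
    rw [mul_comm, Real.exp_mul]
    exact Real.rpow_le_rpow (by positivity) (by linarith [Real.add_one_le_exp |v|]) hs
  calc _ ≤ Real.exp (s * |v|) * Real.exp (-(2 * Real.pi) * v ^ 2) := by gcongr
    _ ≤ _ := by
      rw [← Real.exp_add, ← Real.exp_add, Real.exp_le_exp]
      nlinarith [sq_nonneg (s - |v|), sq_abs v, Real.pi_gt_three, sq_nonneg s, sq_nonneg v]

/-- The weight is submultiplicative, `1+|u| ≤ (1+|t|)(1+|t-u|)`, and the Gaussian absorbs the factor
in `t - u`. -/
theorem lintegral_one_add_abs_rpow_mul_gaussian_sq_le {s : ℝ} (hs : 0 ≤ s) :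
    ∃ C : ENNReal, C ≠ ⊤ ∧ ∀ t : ℝ, ∫⁻ u, ENNReal.ofReal ((1 + |u|) ^ s) *
      ‖(Real.exp (-Real.pi * (t - u) ^ 2) : ℂ)‖ₑ ^ 2 ≤ C * ENNReal.ofReal ((1 + |t|) ^ s) := by
  refine ⟨∫⁻ v, ENNReal.ofReal (Real.exp (s ^ 2) * Real.exp (-Real.pi * v ^ 2)), ?_, fun t ↦ ?_⟩
  · have : Integrable fun v : ℝ => Real.exp (s ^ 2) * Real.exp (-Real.pi * v ^ 2) :=
      (integrable_exp_neg_mul_sq Real.pi_pos).const_mul _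
    rw [← ofReal_integral_eq_lintegral_ofReal this (Filter.Eventually.of_forall fun v ↦ by positivity)]
    exact ENNReal.ofReal_ne_top
  · rw [← lintegral_mul_const' _ _ ENNReal.ofReal_ne_top,
      ← lintegral_sub_left_eq_self (fun v ↦ ENNReal.ofReal (Real.exp (s ^ 2) *
        Real.exp (-Real.pi * v ^ 2)) * ENNReal.ofReal ((1 + |t|) ^ s)) t]
    refine lintegral_mono fun u ↦ ?_
    rw [← ofReal_norm, Complex.norm_real, Real.norm_eq_abs, Real.abs_exp,
      ← ENNReal.ofReal_pow (Real.exp_pos _).le, ← ENNReal.ofReal_mul (by positivity),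
      ← ENNReal.ofReal_mul (by positivity)]
    refine ENNReal.ofReal_le_ofReal ?_
    have h1 : (1 + |u|) ^ s ≤ (1 + |t|) ^ s * (1 + |t - u|) ^ s := by
      rw [← Real.mul_rpow (by positivity) (by positivity)]
      refine Real.rpow_le_rpow (by positivity) ?_ hs
      have : |u| ≤ |t| + |t - u| := by
        have := abs_sub_abs_le_abs_sub u t
        rw [abs_sub_comm] at this; linarith
      nlinarith [abs_nonneg t, abs_nonneg (t - u)]
    have h2 : Real.exp (-Real.pi * (t - u) ^ 2) ^ 2 = Real.exp (-(2 * Real.pi) * (t - u) ^ 2) := by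
      rw [← Real.exp_nat_mul]; congr 1; push_cast; ring
    rw [h2]
    calc _ ≤ (1 + |t|) ^ s * (1 + |t - u|) ^ s * Real.exp (-(2 * Real.pi) * (t - u) ^ 2) := by
          gcongr
      _ = (1 + |t|) ^ s * ((1 + |t - u|) ^ s * Real.exp (-(2 * Real.pi) * (t - u) ^ 2)) := by ring
      _ ≤ (1 + |t|) ^ s * (Real.exp (s ^ 2) * Real.exp (-Real.pi * (t - u) ^ 2)) := by
          gcongr ?_ * ?_
          exact one_add_abs_rpow_mul_exp_le hs _
      _ = _ := by ring

/-- Plancherel in `ξ` for each `u`, then Tonelli. The constant is independent of `f`, so the bound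
serves `f` and `𝓕 f` alike. -/
theorem lintegral_weight_gaussSTFT_sq_le {s : ℝ} (hs : 0 ≤ s) :
    ∃ C : ENNReal, C ≠ ⊤ ∧ ∀ f : ℝ → ℂ, Continuous f → Integrable f → MemLp f 2 →
      ∫⁻ u, ∫⁻ ξ, ENNReal.ofReal ((1 + |u|) ^ s) * ‖gaussSTFT f u ξ‖ₑ ^ 2 ≤
        C * ∫⁻ t, ENNReal.ofReal ((1 + |t|) ^ s) * ‖f t‖ₑ ^ 2 := by
  obtain ⟨C, hC, h⟩ := lintegral_one_add_abs_rpow_mul_gaussian_sq_le hs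
  refine ⟨C, hC, fun f hfc hf hf2 ↦ ?_⟩
  calc ∫⁻ u, ∫⁻ ξ, ENNReal.ofReal ((1 + |u|) ^ s) * ‖gaussSTFT f u ξ‖ₑ ^ 2
      = ∫⁻ u, ∫⁻ t, ‖f t‖ₑ ^ 2 * (ENNReal.ofReal ((1 + |u|) ^ s) *
          ‖(Real.exp (-Real.pi * (t - u) ^ 2) : ℂ)‖ₑ ^ 2) := by
        refine lintegral_congr fun u ↦ ?_
        rw [lintegral_const_mul' _ _ ENNReal.ofReal_ne_top]
        simp only [gaussSTFT]
        rw [Real.lintegral_enorm_fourier_sq (integrable_mul_gaussian hf u) (memLp_mul_gaussian hf2 u),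
          ← lintegral_const_mul' _ _ ENNReal.ofReal_ne_top]
        refine lintegral_congr fun t ↦ ?_
        rw [enorm_mul, mul_pow]
        ring
    _ = ∫⁻ t, ∫⁻ u, ‖f t‖ₑ ^ 2 * (ENNReal.ofReal ((1 + |u|) ^ s) *
          ‖(Real.exp (-Real.pi * (t - u) ^ 2) : ℂ)‖ₑ ^ 2) := by
        refine lintegral_lintegral_swap ?_
        refine Measurable.aemeasurable ?_
        have := hfc.measurable
        fun_prop
    _ ≤ ∫⁻ t, C * (ENNReal.ofReal ((1 + |t|) ^ s) * ‖f t‖ₑ ^ 2) := by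
        refine lintegral_mono fun t ↦ ?_
        rw [lintegral_const_mul' _ _ (by finiteness)]
        calc _ ≤ ‖f t‖ₑ ^ 2 * (C * ENNReal.ofReal ((1 + |t|) ^ s)) := by gcongr; exact h t
          _ = _ := by ring
    _ = _ := lintegral_const_mul' _ _ hC

/-! ### Weighted Cauchy–Schwarz and the local majorant -/

/-- Weighted Cauchy–Schwarz inequality. -/
theorem lintegral_mul_sq_le_weighted {F G : ℝ → ENNReal} (hF : Measurable F) (hG : Measurable G)
    {w : ℝ → ℝ} (hw : Measurable w) (hpos : ∀ x, 0 < w x) :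
    (∫⁻ x, F x * G x) ^ 2 ≤
      (∫⁻ x, ENNReal.ofReal (w x) * F x ^ 2) * ∫⁻ x, ENNReal.ofReal (w x)⁻¹ * G x ^ 2 := by
  have h := ENNReal.lintegral_mul_le_Lp_mul_Lq volume (p := 2) (q := 2) Real.HolderConjugate.two_two
    (f := fun x ↦ ENNReal.ofReal (√(w x)) * F x) (g := fun x ↦ ENNReal.ofReal (√(w x))⁻¹ * G x)
    (by fun_prop) (by fun_prop)
  have h1 : ∀ x, ((fun x ↦ ENNReal.ofReal (√(w x)) * F x) *
      fun x ↦ ENNReal.ofReal (√(w x))⁻¹ * G x) x = F x * G x := by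
    intro x
    have : ENNReal.ofReal (√(w x)) * ENNReal.ofReal (√(w x))⁻¹ = 1 := by
      rw [← ENNReal.ofReal_mul (Real.sqrt_nonneg _),
        mul_inv_cancel₀ (Real.sqrt_pos.2 (hpos x)).ne', ENNReal.ofReal_one]
    calc _ = (ENNReal.ofReal (√(w x)) * ENNReal.ofReal (√(w x))⁻¹) * (F x * G x) := by
          simp only [Pi.mul_apply]; ring
      _ = _ := by rw [this, one_mul]
  have h2 : ∀ x, (ENNReal.ofReal (√(w x)) * F x) ^ (2 : ℝ) = ENNReal.ofReal (w x) * F x ^ 2 := by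
    intro x
    rw [ENNReal.rpow_ofNat, mul_pow, ← ENNReal.ofReal_pow (Real.sqrt_nonneg _),
      Real.sq_sqrt (hpos x).le]
  have h3 : ∀ x, (ENNReal.ofReal (√(w x))⁻¹ * G x) ^ (2 : ℝ) =
      ENNReal.ofReal (w x)⁻¹ * G x ^ 2 := by
    intro x
    rw [ENNReal.rpow_ofNat, mul_pow, ← ENNReal.ofReal_pow (by positivity), inv_pow,
      Real.sq_sqrt (hpos x).le]
  simp only [h1, h2, h3] at h
  calc _ ≤ _ := pow_le_pow_left' h 2
    _ = _ := by
      rw [mul_pow, ← ENNReal.rpow_natCast, ← ENNReal.rpow_natCast, ← ENNReal.rpow_mul,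
        ← ENNReal.rpow_mul]
      simp

theorem integrable_one_add_abs_rpow {r : ℝ} (hr : 1 < r) :
    Integrable fun x : ℝ => (1 + |x|) ^ (-r) :=
  integrable_one_add_norm (E := ℝ) (by simpa using hr)

theorem lintegral_add_abs_rpow {r A : ℝ} (hr : 1 < r) (hA : 0 < A) :
    ∫⁻ ξ : ℝ, ENNReal.ofReal ((A + |ξ|) ^ (-r)) =
      ENNReal.ofReal (A ^ (1 - r)) * ENNReal.ofReal (∫ ξ : ℝ, (1 + |ξ|) ^ (-r)) := by
  have hi := integrable_one_add_abs_rpow hr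
  have h1 : ∀ ξ : ℝ, (A + |ξ|) ^ (-r) = A ^ (-r) * (1 + |A⁻¹ * ξ|) ^ (-r) := by
    intro ξ
    rw [← Real.mul_rpow hA.le (by positivity), abs_mul, abs_of_pos (inv_pos.2 hA)]
    congr 1
    field_simp
  have hi' : Integrable fun ξ : ℝ => (A + |ξ|) ^ (-r) := by
    simp_rw [h1]
    exact (hi.comp_mul_left' (inv_ne_zero hA.ne')).const_mul _
  rw [← ofReal_integral_eq_lintegral_ofReal hi' (Filter.Eventually.of_forall fun ξ ↦ by positivity),
    ← ENNReal.ofReal_mul (by positivity)]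
  congr 1
  simp_rw [h1]
  rw [integral_const_mul, Measure.integral_comp_inv_mul_left (fun x : ℝ => (1 + |x|) ^ (-r)) A,
    abs_of_pos hA, smul_eq_mul, ← mul_assoc]
  congr 1
  rw [sub_eq_neg_add, Real.rpow_add hA, Real.rpow_one]

theorem add_rpow_le_two_rpow_mul {a b r : ℝ} (ha : 0 ≤ a) (hb : 0 ≤ b) (hr : 0 ≤ r) :
    (a + b) ^ r ≤ 2 ^ r * (a ^ r + b ^ r) := by
  have h : (a + b) ^ r ≤ (2 * max a b) ^ r :=
    Real.rpow_le_rpow (by positivity) (by linarith [le_max_left a b, le_max_right a b]) hr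
  rw [Real.mul_rpow (by norm_num) (by positivity)] at h
  refine h.trans ?_
  gcongr
  rcases max_choice a b with h | h <;> rw [h]
  · linarith [Real.rpow_nonneg hb r]
  · linarith [Real.rpow_nonneg ha r]

/-- A continuous function with weighted `L²` bounds in time and in frequency is locally dominated
by a function in a weighted `L²` space. -/
theorem exists_local_majorant {r s : ℝ} (hr : 1 < r) (hs : 0 ≤ s) {f : ℝ → ℂ} (hfc : Continuous f)
    (hf : Integrable f) (hf2 : MemLp f 2) (hF : Integrable (𝓕 f)) (hF2 : MemLp (𝓕 f) 2)
    (htime : ∫⁻ t, ENNReal.ofReal ((1 + |t|) ^ s) * ‖f t‖ₑ ^ 2 ≠ ⊤)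
    (hfreq : ∫⁻ ξ, ENNReal.ofReal ((1 + |ξ|) ^ r) * ‖𝓕 f ξ‖ₑ ^ 2 ≠ ⊤) :
    ∃ N : ℝ → ENNReal, Measurable N ∧
      ∫⁻ u, ENNReal.ofReal ((1 + |u|) ^ (s * (1 - 1 / r))) * N u ^ 2 ≠ ⊤ ∧
      ∀ x u, ‖f x‖ₑ ≤ ENNReal.ofReal (Real.exp (Real.pi * (x - u) ^ 2)) * N u := by
  have hV := measurable_gaussSTFT hfc
  have hFc : Continuous (𝓕 f) := Real.continuous_fourier hf
  refine ⟨fun u ↦ ∫⁻ ξ, ‖gaussSTFT f u ξ‖ₑ, ?_, ?_, enorm_le_lintegral_gaussSTFT hfc hf⟩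
  · exact Measurable.lintegral_prod_right' hV.enorm
  set K := ENNReal.ofReal (∫ ξ : ℝ, (1 + |ξ|) ^ (-r)) with hK
  obtain ⟨C₁, hC₁, h₁⟩ := lintegral_weight_gaussSTFT_sq_le hs
  obtain ⟨C₂, hC₂, h₂⟩ := lintegral_weight_gaussSTFT_sq_le (s := r) (by linarith)
  have hVu (u : ℝ) : Measurable (gaussSTFT f u) := hV.of_uncurry_left
  have pt (u : ℝ) : ENNReal.ofReal ((1 + |u|) ^ (s * (1 - 1 / r))) *
      (∫⁻ ξ, ‖gaussSTFT f u ξ‖ₑ) ^ 2 ≤ K * ENNReal.ofReal (2 ^ r) *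
        ((∫⁻ ξ, ENNReal.ofReal ((1 + |u|) ^ s) * ‖gaussSTFT f u ξ‖ₑ ^ 2) +
          ∫⁻ ξ, ENNReal.ofReal ((1 + |ξ|) ^ r) * ‖gaussSTFT f u ξ‖ₑ ^ 2) := by
    have hu : 0 < 1 + |u| := by positivity
    -- This `A` balances the two weights: `A ^ r = (1+|u|)^s`, so `(A+|ξ|)^r` is dominated by their
    -- sum, and the dual integral contributes `A ^ (1 - r) = (1+|u|)^{-s(1-1/r)}`.
    set A := (1 + |u|) ^ (s / r) with hA
    have hApos : 0 < A := by positivity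
    have cs := lintegral_mul_sq_le_weighted (F := fun ξ ↦ ‖gaussSTFT f u ξ‖ₑ) (G := fun _ ↦ 1)
      (by fun_prop) (by fun_prop) (w := fun ξ ↦ (A + |ξ|) ^ r) (by fun_prop)
      (fun ξ ↦ by positivity)
    have hinv : ∀ ξ : ℝ, ((A + |ξ|) ^ r)⁻¹ = (A + |ξ|) ^ (-r) := fun ξ ↦
      (Real.rpow_neg (by positivity) _).symm
    simp only [mul_one, one_pow, hinv, lintegral_add_abs_rpow hr hApos] at cs
    have hAr : A ^ r = (1 + |u|) ^ s := by
      rw [hA, ← Real.rpow_mul hu.le]; congr 1; field_simp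
    have hA1 : (1 + |u|) ^ (s * (1 - 1 / r)) * A ^ (1 - r) = 1 := by
      rw [hA, ← Real.rpow_mul hu.le, ← Real.rpow_add hu]
      convert Real.rpow_zero _
      field_simp
      ring
    have hw : ∫⁻ ξ, ENNReal.ofReal ((A + |ξ|) ^ r) * ‖gaussSTFT f u ξ‖ₑ ^ 2 ≤
        ENNReal.ofReal (2 ^ r) *
        ((∫⁻ ξ, ENNReal.ofReal ((1 + |u|) ^ s) * ‖gaussSTFT f u ξ‖ₑ ^ 2) +
          ∫⁻ ξ, ENNReal.ofReal ((1 + |ξ|) ^ r) * ‖gaussSTFT f u ξ‖ₑ ^ 2) := by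
      have hm := hVu u
      rw [← lintegral_add_left (by fun_prop), ← lintegral_const_mul' _ _ ENNReal.ofReal_ne_top]
      refine lintegral_mono fun ξ ↦ ?_
      rw [← add_mul, ← mul_assoc, ← ENNReal.ofReal_add (by positivity) (by positivity),
        ← ENNReal.ofReal_mul (by positivity)]
      gcongr
      refine (add_rpow_le_two_rpow_mul hApos.le (abs_nonneg ξ) (by linarith)).trans ?_
      rw [hAr]
      gcongr
      linarith
    calc _ ≤ ENNReal.ofReal ((1 + |u|) ^ (s * (1 - 1 / r))) *
          ((∫⁻ ξ, ENNReal.ofReal ((A + |ξ|) ^ r) * ‖gaussSTFT f u ξ‖ₑ ^ 2) *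
            (ENNReal.ofReal (A ^ (1 - r)) * K)) := by gcongr
      _ = (ENNReal.ofReal ((1 + |u|) ^ (s * (1 - 1 / r))) * ENNReal.ofReal (A ^ (1 - r))) * (K *
          ∫⁻ ξ, ENNReal.ofReal ((A + |ξ|) ^ r) * ‖gaussSTFT f u ξ‖ₑ ^ 2) := by ring
      _ = K * ∫⁻ ξ, ENNReal.ofReal ((A + |ξ|) ^ r) * ‖gaussSTFT f u ξ‖ₑ ^ 2 := by
          rw [← ENNReal.ofReal_mul (by positivity), hA1, ENNReal.ofReal_one, one_mul]
      _ ≤ _ := by rw [mul_assoc]; gcongr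
  -- The rotation identity turns the frequency weight into a time weight for `𝓕 f`.
  have hsecond : ∫⁻ u, ∫⁻ ξ, ENNReal.ofReal ((1 + |ξ|) ^ r) * ‖gaussSTFT f u ξ‖ₑ ^ 2 =
      ∫⁻ ξ, ∫⁻ u, ENNReal.ofReal ((1 + |ξ|) ^ r) * ‖gaussSTFT (𝓕 f) ξ u‖ₑ ^ 2 := by
    rw [lintegral_lintegral_swap]
    · refine lintegral_congr fun ξ ↦ ?_
      have : ∀ u, ‖gaussSTFT f u ξ‖ₑ = ‖gaussSTFT (𝓕 f) ξ (-u)‖ₑ := fun u ↦ by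
        rw [← ofReal_norm, ← ofReal_norm, norm_gaussSTFT_eq hf]
      simp only [this]
      exact lintegral_neg_eq_self
        (fun u ↦ ENNReal.ofReal ((1 + |ξ|) ^ r) * ‖gaussSTFT (𝓕 f) ξ u‖ₑ ^ 2)
    · refine Measurable.aemeasurable ?_
      exact Measurable.mul (by fun_prop) (hV.enorm.pow_const 2)
  refine ne_top_of_le_ne_top ?_ (lintegral_mono fun u ↦ pt u)
  rw [lintegral_const_mul' _ _ (by finiteness), lintegral_add_left, hsecond]
  · refine ENNReal.mul_ne_top (by finiteness) (ENNReal.add_ne_top.2 ⟨?_, ?_⟩)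
    · exact ne_top_of_le_ne_top (ENNReal.mul_ne_top hC₁ htime) (h₁ f hfc hf hf2)
    · exact ne_top_of_le_ne_top (ENNReal.mul_ne_top hC₂ hfreq) (h₂ _ hFc hF hF2)
  · refine Measurable.lintegral_prod_right'
      (f := fun p : ℝ × ℝ ↦ ENNReal.ofReal ((1 + |p.1|) ^ s) * ‖gaussSTFT f p.1 p.2‖ₑ ^ 2) ?_
    exact Measurable.mul (by fun_prop) (hV.enorm.pow_const 2)

/-! ### The integral that produces the modulus -/

theorem integral_one_add_abs_eq (G : ℝ → ℝ) :
    ∫ u, G (1 + |u|) = 2 * ∫ t in Set.Ioi (1 : ℝ), G t := by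
  rw [integral_comp_abs (f := fun x ↦ G (1 + x))]
  congr 1
  rw [← integral_indicator measurableSet_Ioi, ← integral_indicator measurableSet_Ioi,
    ← integral_add_left_eq_self ((Set.Ioi (1 : ℝ)).indicator G) (1 : ℝ)]
  congr 1
  ext x
  simp [Set.indicator_apply]

theorem integrableOn_rpow_mul_min_sq {σ : ℝ} (hσ : 1 < σ) {c : ℝ} (hc : 0 < c) (h : ℝ) :
    IntegrableOn (fun t : ℝ => t ^ (-σ) * min 1 (|h| * t) ^ 2) (Set.Ioi c) := by
  refine (integrableOn_Ioi_rpow_of_lt (a := -σ) (by linarith) hc).mono' ?_ ?_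
  · exact Measurable.aestronglyMeasurable (by fun_prop)
  · refine (ae_restrict_mem measurableSet_Ioi).mono fun t ht ↦ ?_
    have ht' : 0 < t := hc.trans ht
    have hm : 0 ≤ min 1 (|h| * t) := le_min zero_le_one (by positivity)
    rw [Real.norm_of_nonneg (by positivity)]
    exact mul_le_of_le_one_right (by positivity) (pow_le_one₀ hm (min_le_left _ _))

/-- The range is split at `t = |h|⁻¹`, where the minimum changes branch. -/
theorem integral_rpow_mul_min_sq_le {σ : ℝ} (hσ : 1 < σ) {h : ℝ} (h0 : h ≠ 0) (h1 : |h| < 1) :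
    ∫ t in Set.Ioi (1 : ℝ), t ^ (-σ) * min 1 (|h| * t) ^ 2 ≤
      |h| ^ 2 * (∫ t in (1 : ℝ)..|h|⁻¹, t ^ (2 - σ)) + |h| ^ (σ - 1) / (σ - 1) := by
  have hpos : 0 < |h| := abs_pos.2 h0
  have hH : 1 < |h|⁻¹ := (one_lt_inv₀ hpos).2 h1
  have hHpos : 0 < |h|⁻¹ := by positivity
  rw [← Set.Ioc_union_Ioi_eq_Ioi hH.le, setIntegral_union (Set.Ioc_disjoint_Ioi le_rfl)
    measurableSet_Ioi ((integrableOn_rpow_mul_min_sq hσ one_pos h).mono_set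
      Set.Ioc_subset_Ioi_self) (integrableOn_rpow_mul_min_sq hσ hHpos h)]
  refine add_le_add ?_ ?_
  · rw [intervalIntegral.integral_of_le hH.le, ← integral_const_mul]
    refine setIntegral_mono_on ((integrableOn_rpow_mul_min_sq hσ one_pos h).mono_set
      Set.Ioc_subset_Ioi_self) ?_ measurableSet_Ioc fun t ht ↦ ?_
    · refine Integrable.const_mul ?_ _
      have := intervalIntegral.intervalIntegrable_rpow (μ := volume) (r := 2 - σ) (a := 1)
        (b := |h|⁻¹) (Or.inr ?_)
      · exact (intervalIntegrable_iff_integrableOn_Ioc_of_le hH.le).1 this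
      · rw [Set.uIcc_of_le hH.le]
        exact fun h ↦ absurd h.1 (by norm_num)
    · have ht' : 0 < t := one_pos.trans ht.1
      calc t ^ (-σ) * min 1 (|h| * t) ^ 2 ≤ t ^ (-σ) * (|h| * t) ^ 2 := by
            gcongr
            exact min_le_right _ _
        _ = |h| ^ 2 * t ^ (2 - σ) := by
            rw [sub_eq_add_neg, Real.rpow_add ht', Real.rpow_ofNat]; ring
  · calc _ ≤ ∫ t in Set.Ioi |h|⁻¹, t ^ (-σ) := by
          refine setIntegral_mono_on (integrableOn_rpow_mul_min_sq hσ hHpos h)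
            (integrableOn_Ioi_rpow_of_lt (by linarith) hHpos) measurableSet_Ioi fun t ht ↦ ?_
          have ht' : 0 < t := hHpos.trans ht
          have hm : 0 ≤ min 1 (|h| * t) := le_min zero_le_one (by positivity)
          exact mul_le_of_le_one_right (by positivity) (pow_le_one₀ hm (min_le_left _ _))
      _ = _ := by
          rw [integral_Ioi_rpow_of_lt (by linarith) hHpos, Real.inv_rpow hpos.le,
            ← Real.rpow_neg hpos.le, show -(-σ + 1) = σ - 1 by ring,
            show -σ + 1 = -(σ - 1) by ring, neg_div_neg_eq]

theorem zakModulus_nonneg {r s : ℝ} (x : ℝ) : 0 ≤ zakModulus r s x := by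
  unfold zakModulus
  split_ifs
  · positivity
  · exact mul_nonneg (by positivity) (Real.log_nonneg (by simp))
  · positivity

theorem half_le_zakModulus {r s : ℝ} (hr : 0 < r) (hrs : 1 / r + 1 / s < 1) {x : ℝ}
    (hx : 1 ≤ |x|) : 1 / 2 ≤ zakModulus r s x := by
  unfold zakModulus
  split_ifs
  · have : 0 ≤ 2 - r * (3 / r + 1 / s - 1) := by
      have h : r * (3 / r + 1 / s - 1) = 3 + r * (1 / s - 1) := by field_simp; ring
      have h2 : r * (1 / r + 1 / s) < r * 1 := mul_lt_mul_of_pos_left hrs hr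
      have h3 : r * (1 / r + 1 / s) = 1 + r * (1 / s) := by field_simp
      linarith
    linarith [Real.one_le_rpow hx this]
  · have hx0 : 0 < |x| := by linarith
    have hl := Real.one_sub_inv_le_log_of_pos (x := 1 + 1 / |x|) (by positivity)
    have : 1 - (1 + 1 / |x|)⁻¹ = 1 / (1 + |x|) := by field_simp; ring
    rw [this] at hl
    calc (1 : ℝ) / 2 ≤ |x| ^ 2 * (1 / (1 + |x|)) := by
          rw [mul_one_div, div_le_div_iff₀ (by norm_num) (by positivity)]
          nlinarith
      _ ≤ _ := by gcongr
  · nlinarith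

theorem integral_one_add_abs_rpow_mul_min_sq_le {r s : ℝ} (hr : 0 < r) (hs : 0 < s)
    (hrs : 1 / r + 1 / s < 1) : ∃ C : ℝ, 0 < C ∧ ∀ h : ℝ,
      ∫ u, (1 + |u|) ^ (-(s * (1 - 1 / r))) * min 1 (|h| * (1 + |u|)) ^ 2 ≤
        C * zakModulus s r h := by
  set σ := s * (1 - 1 / r) with hσd
  have hσ : 1 < σ := by
    have := mul_lt_mul_of_pos_left hrs hs
    have h2 : s * (1 / r + 1 / s) = s * (1 / r) + 1 := by field_simp
    rw [h2] at this
    rw [hσd]; linarith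
  -- In terms of `σ` the exponent of the modulus is `σ - 1`, and its case distinction compares `σ`
  -- with `3`.
  have hexp : 2 - s * (3 / s + 1 / r - 1) = σ - 1 := by
    rw [hσd]; field_simp; ring
  have hcond1 : 1 < 3 / s + 1 / r ↔ σ < 3 := by
    rw [hσd, ← lt_div_iff₀' hs]; constructor <;> intro h <;> linarith
  have hcond2 : 3 / s + 1 / r = 1 ↔ σ = 3 := by
    rw [hσd, mul_comm s, ← eq_div_iff hs.ne']; constructor <;> intro h <;> linarith
  set K := ∫ u : ℝ, (1 + |u|) ^ (-σ) with hK
  have hK0 : 0 ≤ K := integral_nonneg fun u ↦ by positivity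
  have hintble (h : ℝ) :
      Integrable fun u : ℝ => (1 + |u|) ^ (-σ) * min 1 (|h| * (1 + |u|)) ^ 2 := by
    refine (integrable_one_add_abs_rpow hσ).mono' (Measurable.aestronglyMeasurable (by fun_prop))
      (Filter.Eventually.of_forall fun t ↦ ?_)
    have hm : 0 ≤ min 1 (|h| * (1 + |t|)) := le_min zero_le_one (by positivity)
    rw [Real.norm_of_nonneg (by positivity)]
    exact mul_le_of_le_one_right (by positivity) (pow_le_one₀ hm (min_le_left _ _))
  -- it suffices to treat small increments
  suffices hsmall : ∃ C : ℝ, 0 ≤ C ∧ ∀ h : ℝ, h ≠ 0 → |h| < 1 →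
      ∫ t in Set.Ioi (1 : ℝ), t ^ (-σ) * min 1 (|h| * t) ^ 2 ≤ C * zakModulus s r h by
    obtain ⟨C, hC, hle⟩ := hsmall
    -- `2 * C` covers `|h| < 1`, the integral over the line being twice that over the half-line; `2
    -- * K` covers `|h| ≥ 1`, where the modulus is at least `1/2`.
    refine ⟨2 * C + 2 * K + 1, by positivity, fun h ↦ ?_⟩
    have hφ := zakModulus_nonneg (r := s) (s := r) h
    rcases eq_or_ne h 0 with rfl | h0
    · simp only [abs_zero, zero_mul, min_eq_right zero_le_one]
      simpa using mul_nonneg (by positivity) hφ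
    rcases lt_or_ge |h| 1 with h1 | h1
    · rw [integral_one_add_abs_eq (fun t ↦ t ^ (-σ) * min 1 (|h| * t) ^ 2)]
      nlinarith [hle h h0 h1, mul_nonneg hK0 hφ]
    · have h2 := half_le_zakModulus hs (by linarith) (r := s) (s := r) h1
      have : ∫ u, (1 + |u|) ^ (-σ) * min 1 (|h| * (1 + |u|)) ^ 2 ≤ K := by
        refine integral_mono (hintble h) (integrable_one_add_abs_rpow hσ) fun t ↦ ?_
        have hm : 0 ≤ min 1 (|h| * (1 + |t|)) := le_min zero_le_one (by positivity)
        exact mul_le_of_le_one_right (by positivity) (pow_le_one₀ hm (min_le_left _ _))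
      nlinarith [mul_nonneg hC hφ]
  rcases lt_trichotomy σ 3 with h3 | h3 | h3
  · refine ⟨1 / (3 - σ) + 1 / (σ - 1),
      add_nonneg (one_div_nonneg.2 (by linarith)) (one_div_nonneg.2 (by linarith)),
      fun h h0 h1 ↦ (integral_rpow_mul_min_sq_le hσ h0 h1).trans ?_⟩
    have hpos : 0 < |h| := abs_pos.2 h0
    rw [zakModulus, if_pos (hcond1.2 h3), hexp, add_mul]
    refine add_le_add ?_ (le_of_eq (by ring))
    rw [integral_rpow (Or.inl (by linarith)), Real.one_rpow, show 2 - σ + 1 = 3 - σ by ring,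
      Real.inv_rpow hpos.le, ← Real.rpow_neg hpos.le, mul_div_assoc', one_div_mul_eq_div]
    refine div_le_div_of_nonneg_right ?_ (by linarith)
    have : |h| ^ 2 * |h| ^ (-(3 - σ)) = |h| ^ (σ - 1) := by
      rw [← Real.rpow_ofNat, ← Real.rpow_add hpos]; congr 1; ring
    rw [mul_sub, this]
    nlinarith
  -- At `σ = 3` the head gives `|h|² log |h|⁻¹` and the tail `|h|²/2`; the latter is absorbed since
  -- `log (1 + |h|⁻¹) ≥ log 2 ≥ 1/2`.
  · refine ⟨2, by norm_num, fun h h0 h1 ↦ (integral_rpow_mul_min_sq_le hσ h0 h1).trans ?_⟩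
    have hpos : 0 < |h| := abs_pos.2 h0
    have hH : 1 < |h|⁻¹ := (one_lt_inv₀ hpos).2 h1
    rw [zakModulus, if_neg (by rw [hcond1]; linarith), if_pos (hcond2.2 h3), h3]
    have hlog : ∫ t in (1 : ℝ)..|h|⁻¹, t ^ ((2 : ℝ) - 3) = Real.log |h|⁻¹ := by
      have : ∀ t : ℝ, t ^ ((2 : ℝ) - 3) = t⁻¹ := fun t ↦ by
        rw [← Real.rpow_neg_one]; norm_num
      simp only [this]
      rw [integral_inv_of_pos one_pos (by positivity), div_one]
    rw [hlog, one_div]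
    have hl1 : Real.log |h|⁻¹ ≤ Real.log (1 + |h|⁻¹) := Real.log_le_log (by positivity) (by linarith)
    have hl2 : 1 / 2 ≤ Real.log (1 + |h|⁻¹) := by
      have := Real.log_le_log (x := 2) (by norm_num) (show 2 ≤ 1 + |h|⁻¹ by linarith)
      linarith [Real.log_two_gt_d9]
    have h22 : |h| ^ ((3 : ℝ) - 1) = |h| ^ 2 := by rw [← Real.rpow_ofNat]; norm_num
    rw [h22]
    have : 0 < |h| ^ 2 := by positivity
    nlinarith
  -- For `σ > 3` no splitting is needed: `t ^ (2 - σ)` is integrable at infinity.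
  · have hi : IntegrableOn (fun t : ℝ ↦ t ^ (2 - σ)) (Set.Ioi 1) :=
      integrableOn_Ioi_rpow_of_lt (by linarith) one_pos
    refine ⟨∫ t in Set.Ioi (1 : ℝ), t ^ (2 - σ), ?_, fun h h0 h1 ↦ ?_⟩
    · exact setIntegral_nonneg measurableSet_Ioi fun t ht ↦
        Real.rpow_nonneg (zero_le_one.trans (le_of_lt ht)) _
    · rw [zakModulus, if_neg (by rw [hcond1]; linarith), if_neg (by rw [hcond2]; linarith),
        mul_comm, ← integral_const_mul]
      refine setIntegral_mono_on (integrableOn_rpow_mul_min_sq hσ one_pos h) (hi.const_mul _)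
        measurableSet_Ioi fun t ht ↦ ?_
      have ht' : 0 < t := one_pos.trans ht
      calc t ^ (-σ) * min 1 (|h| * t) ^ 2 ≤ t ^ (-σ) * (|h| * t) ^ 2 := by
            gcongr
            exact min_le_right _ _
        _ = |h| ^ 2 * t ^ (2 - σ) := by
            rw [sub_eq_add_neg, Real.rpow_add ht', Real.rpow_ofNat]; ring

/-! ### Summable majorants with tail bounds -/

theorem one_lt_mul_one_sub_one_div {r s : ℝ} (hs : 0 < s) (hrs : 1 / r + 1 / s < 1) :
    1 < s * (1 - 1 / r) := by
  have := mul_lt_mul_of_pos_left hrs hs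
  have h2 : s * (1 / r + 1 / s) = s * (1 / r) + 1 := by field_simp
  rw [h2] at this
  linarith

theorem tsum_setLIntegral_Ioc (G : ℝ → ENNReal) :
    ∑' n : ℤ, ∫⁻ u in Set.Ioc (n : ℝ) (n + 1), G u = ∫⁻ u, G u := by
  rw [← lintegral_iUnion (fun n ↦ measurableSet_Ioc) (Set.pairwise_disjoint_Ioc_intCast ℝ),
    iUnion_Ioc_intCast, Measure.restrict_univ]

theorem min_one_mul_le_two_mul {h : ℝ} {n : ℤ} {u : ℝ} (hu : |u - n| ≤ 1) :
    min 1 (|h| * (1 + |(n : ℝ)|)) ≤ 2 * min 1 (|h| * (1 + |u|)) := by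
  have h1 : |(n : ℝ)| ≤ |u| + 1 := by
    have := abs_sub_abs_le_abs_sub (n : ℝ) u
    rw [abs_sub_comm] at this; linarith
  have h2 : |h| * (1 + |(n : ℝ)|) ≤ 2 * (|h| * (1 + |u|)) := by
    nlinarith [abs_nonneg h, abs_nonneg u, mul_nonneg (abs_nonneg h) (abs_nonneg u),
      mul_le_mul_of_nonneg_left h1 (abs_nonneg h)]
  rcases le_total 1 (|h| * (1 + |u|)) with h3 | h3
  · rw [min_eq_left h3]
    exact (min_le_left _ _).trans (by norm_num)
  · rw [min_eq_right h3]
    exact (min_le_right _ _).trans h2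

/-- A continuous function with weighted `L²` bounds in time and in frequency belongs to the Wiener
amalgam space, with a quantitative bound for the tails of its majorant. -/
theorem exists_summable_majorant {r s : ℝ} (hr : 0 < r) (hs : 0 < s) (hrs : 1 / r + 1 / s < 1)
    {f : ℝ → ℂ} (hfc : Continuous f)
    (hf : Integrable f) (hf2 : MemLp f 2) (hF : Integrable (𝓕 f)) (hF2 : MemLp (𝓕 f) 2)
    (htime : ∫⁻ t, ENNReal.ofReal ((1 + |t|) ^ s) * ‖f t‖ₑ ^ 2 ≠ ⊤)
    (hfreq : ∫⁻ ξ, ENNReal.ofReal ((1 + |ξ|) ^ r) * ‖𝓕 f ξ‖ₑ ^ 2 ≠ ⊤) (R : ℝ) :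
    ∃ (a : ℤ → ℝ) (C : ℝ), (∀ n, 0 ≤ a n) ∧ Summable a ∧ 0 ≤ C ∧
      (∀ (n : ℤ) (x : ℝ), |x - n| ≤ R → ‖f x‖ ≤ a n) ∧
      ∀ h : ℝ, (∑' n : ℤ, a n * min 1 (|h| * (1 + |(n : ℝ)|))) ^ 2 ≤ C * zakModulus s r h := by
  have hr1 : 1 < r := by
    have : 0 < 1 / s := by positivity
    exact (one_div_lt_one_div hr one_pos).1 (by rw [one_div_one]; linarith)
  obtain ⟨N, hNm, hN2, hN⟩ := exists_local_majorant hr1 hs.le hfc hf hf2 hF hF2 htime hfreq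
  obtain ⟨C₀, hC₀, hC₀le⟩ := integral_one_add_abs_rpow_mul_min_sq_le hr hs hrs
  have hσ := one_lt_mul_one_sub_one_div hs hrs
  set σ := s * (1 - 1 / r)
  set B := ∫⁻ u, ENNReal.ofReal ((1 + |u|) ^ σ) * N u ^ 2 with hB
  have cs (G : ℝ → ENNReal) (hG : Measurable G) : (∫⁻ u, N u * G u) ^ 2 ≤
      B * ∫⁻ u, ENNReal.ofReal ((1 + |u|) ^ (-σ)) * G u ^ 2 := by
    have := lintegral_mul_sq_le_weighted hNm hG (w := fun u ↦ (1 + |u|) ^ σ) (by fun_prop)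
      (fun u ↦ by positivity)
    have hinv : ∀ u : ℝ, ((1 + |u|) ^ σ)⁻¹ = (1 + |u|) ^ (-σ) := fun u ↦
      (Real.rpow_neg (by positivity) _).symm
    simpa only [hinv] using this
  have hN1 : ∫⁻ u, N u ≠ ⊤ := by
    have h := cs (fun _ ↦ 1) measurable_const
    simp only [mul_one, one_pow] at h
    rw [← ofReal_integral_eq_lintegral_ofReal (integrable_one_add_abs_rpow hσ)
      (Filter.Eventually.of_forall fun u ↦ by positivity)] at h
    have := ne_top_of_le_ne_top (ENNReal.mul_ne_top hN2 ENNReal.ofReal_ne_top) h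
    exact fun h' ↦ this (by rw [h']; simp)
  -- If `|x - n| ≤ R` and `u ∈ (n, n+1]`, then `|x - u| ≤ R + 1`; averaging the pointwise bound over
  -- such `u` gives `A n`.
  set E := ENNReal.ofReal (Real.exp (Real.pi * (R + 1) ^ 2)) with hE
  have hEtop : E ≠ ⊤ := ENNReal.ofReal_ne_top
  set A : ℤ → ENNReal := fun n ↦ E * ∫⁻ u in Set.Ioc (n : ℝ) (n + 1), N u with hA
  have hAsum : ∑' n, A n ≠ ⊤ := by
    rw [hA, ENNReal.tsum_mul_left, tsum_setLIntegral_Ioc]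
    exact ENNReal.mul_ne_top hEtop hN1
  have hAtop : ∀ n, A n ≠ ⊤ := ENNReal.ne_top_of_tsum_ne_top hAsum
  have hbound (h : ℝ) : ∑' n, A n * ENNReal.ofReal (min 1 (|h| * (1 + |(n : ℝ)|))) ≤
      E * ∫⁻ u, N u * ENNReal.ofReal (2 * min 1 (|h| * (1 + |u|))) := by
    rw [← tsum_setLIntegral_Ioc, ← ENNReal.tsum_mul_left]
    refine ENNReal.tsum_le_tsum fun n ↦ ?_
    rw [hA, mul_assoc, ← lintegral_mul_const' _ _ ENNReal.ofReal_ne_top]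
    refine mul_le_mul' le_rfl
      (lintegral_mono_ae ((ae_restrict_mem measurableSet_Ioc).mono fun u hu ↦ ?_))
    gcongr
    refine min_one_mul_le_two_mul ?_
    rw [abs_le]; constructor <;> linarith [hu.1, hu.2]
  refine ⟨fun n ↦ (A n).toReal, (E ^ 2 * B * 4).toReal * C₀, fun n ↦ ENNReal.toReal_nonneg,
    ENNReal.summable_toReal hAsum, by positivity, fun n x hx ↦ ?_, fun h ↦ ?_⟩
  · rw [← toReal_enorm]
    refine ENNReal.toReal_mono (hAtop n) ?_
    have h1 : ∫⁻ u in Set.Ioc (n : ℝ) (n + 1), ‖f x‖ₑ = ‖f x‖ₑ := by simp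
    rw [← h1]
    refine le_of_le_of_eq ?_ (lintegral_const_mul' _ _ hEtop)
    refine lintegral_mono_ae ((ae_restrict_mem measurableSet_Ioc).mono fun u hu ↦ ?_)
    refine (hN x u).trans ?_
    have hxu : |x - u| ≤ R + 1 := by
      rw [abs_le] at hx ⊢; constructor <;> linarith [hu.1, hu.2]
    refine mul_le_mul' (ENNReal.ofReal_le_ofReal (Real.exp_le_exp.2
      (mul_le_mul_of_nonneg_left ?_ Real.pi_pos.le))) le_rfl
    exact sq_le_sq.2 (hxu.trans (le_abs_self _))
  · have hm (t : ℝ) : 0 ≤ min 1 (|h| * (1 + |t|)) := le_min zero_le_one (by positivity)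
    have hφ := zakModulus_nonneg (r := s) (s := r) h
    have e1 : ∑' n : ℤ, (A n).toReal * min 1 (|h| * (1 + |(n : ℝ)|)) =
        (∑' n, A n * ENNReal.ofReal (min 1 (|h| * (1 + |(n : ℝ)|)))).toReal := by
      rw [ENNReal.tsum_toReal_eq fun n ↦ ENNReal.mul_ne_top (hAtop n) ENNReal.ofReal_ne_top]
      simp only [ENNReal.toReal_mul, ENNReal.toReal_ofReal (hm _)]
    have hi : Integrable fun u : ℝ => (1 + |u|) ^ (-σ) * min 1 (|h| * (1 + |u|)) ^ 2 := by
      refine (integrable_one_add_abs_rpow hσ).mono' (Measurable.aestronglyMeasurable (by fun_prop))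
        (Filter.Eventually.of_forall fun t ↦ ?_)
      rw [Real.norm_of_nonneg (by have := hm t; positivity)]
      exact mul_le_of_le_one_right (by positivity) (pow_le_one₀ (hm t) (min_le_left _ _))
    have e2 : ∫⁻ u, ENNReal.ofReal ((1 + |u|) ^ (-σ)) *
        ENNReal.ofReal (2 * min 1 (|h| * (1 + |u|))) ^ 2 ≤
        4 * ENNReal.ofReal (C₀ * zakModulus s r h) := by
      calc _ = ∫⁻ u, 4 * ENNReal.ofReal ((1 + |u|) ^ (-σ) * min 1 (|h| * (1 + |u|)) ^ 2) := by
            refine lintegral_congr fun u ↦ ?_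
            rw [ENNReal.ofReal_mul (by positivity), ENNReal.ofReal_mul (by positivity),
              ENNReal.ofReal_pow (hm u), ENNReal.ofReal_ofNat]
            ring
        _ = 4 * ENNReal.ofReal (∫ u, (1 + |u|) ^ (-σ) * min 1 (|h| * (1 + |u|)) ^ 2) := by
            rw [lintegral_const_mul' _ _ (by norm_num), ofReal_integral_eq_lintegral_ofReal hi
              (Filter.Eventually.of_forall fun u ↦ by have := hm u; positivity)]
        _ ≤ _ := by
            gcongr
            exact hC₀le h
    rw [e1, ← ENNReal.toReal_pow]
    calc _ ≤ ((E ^ 2 * B * 4) * ENNReal.ofReal (C₀ * zakModulus s r h)).toReal := by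
          refine ENNReal.toReal_mono (by finiteness) ?_
          calc _ ≤ (E * ∫⁻ u, N u * ENNReal.ofReal (2 * min 1 (|h| * (1 + |u|)))) ^ 2 :=
                pow_le_pow_left' (hbound h) 2
            _ ≤ E ^ 2 * (B * (4 * ENNReal.ofReal (C₀ * zakModulus s r h))) := by
                rw [mul_pow]
                gcongr
                exact (cs _ (by fun_prop)).trans (by gcongr)
            _ = _ := by ring
      _ = _ := by
          rw [ENNReal.toReal_mul, ENNReal.toReal_ofReal (by positivity)]
          ring

/-! ### Zak transform and Poisson summation -/

/-- Membership in the Wiener amalgam space: the local suprema over unit translates are summable. -/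
def WienerBounded (f : ℝ → ℂ) : Prop :=
  ∀ R : ℝ, ∃ a : ℤ → ℝ, Summable a ∧ ∀ (n : ℤ) (x : ℝ), |x - n| ≤ R → ‖f x‖ ≤ a n

theorem norm_exp_two_pi_I_mul (t : ℝ) : ‖Complex.exp (2 * Real.pi * Complex.I * t)‖ = 1 := by
  rw [show 2 * Real.pi * Complex.I * (t : ℂ) = ((2 * Real.pi * t : ℝ) : ℂ) * Complex.I by
    push_cast; ring, Complex.norm_exp_ofReal_mul_I]

theorem norm_exp_two_pi_I_mul_sub_le {t t' d : ℝ} (h : |t - t'| ≤ d) :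
    ‖Complex.exp (2 * Real.pi * Complex.I * t) - Complex.exp (2 * Real.pi * Complex.I * t')‖ ≤
      2 * Real.pi * min 1 d := by
  have hpi := Real.pi_gt_three
  rw [mul_min_of_nonneg _ _ (by positivity), le_min_iff]
  constructor
  · refine (norm_sub_le _ _).trans ?_
    rw [norm_exp_two_pi_I_mul, norm_exp_two_pi_I_mul]
    linarith
  · have e : Complex.exp (2 * Real.pi * Complex.I * t) - Complex.exp (2 * Real.pi * Complex.I * t') =
        Complex.exp (2 * Real.pi * Complex.I * t') *
          (Complex.exp (Complex.I * ((2 * Real.pi * (t - t') : ℝ) : ℂ)) - 1) := by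
      rw [mul_sub, ← Complex.exp_add, mul_one]
      congr 2
      push_cast
      ring
    rw [e, norm_mul, norm_exp_two_pi_I_mul, one_mul]
    refine Real.norm_exp_I_mul_ofReal_sub_one_le.trans ?_
    rw [Real.norm_eq_abs, abs_mul, abs_of_pos (by positivity)]
    gcongr

theorem norm_tsum_mul_exp_sub_le {c : ℤ → ℂ} {a : ℤ → ℝ} (ha : Summable a)
    (hc : ∀ n, ‖c n‖ ≤ a n) {θ θ' : ℤ → ℝ} {h : ℝ}
    (hθ : ∀ n, |θ n - θ' n| ≤ |h| * (1 + |(n : ℝ)|)) :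
    ‖∑' n, c n * Complex.exp (2 * Real.pi * Complex.I * θ n) -
      ∑' n, c n * Complex.exp (2 * Real.pi * Complex.I * θ' n)‖ ≤
      2 * Real.pi * ∑' n, a n * min 1 (|h| * (1 + |(n : ℝ)|)) := by
  have hs (θ : ℤ → ℝ) : Summable fun n ↦ c n * Complex.exp (2 * Real.pi * Complex.I * θ n) := by
    refine Summable.of_norm_bounded ha fun n ↦ ?_
    rw [norm_mul, norm_exp_two_pi_I_mul, mul_one]
    exact hc n
  have ha0 (n : ℤ) : 0 ≤ a n := (norm_nonneg _).trans (hc n)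
  have hsum : Summable fun n : ℤ ↦ a n * min 1 (|h| * (1 + |(n : ℝ)|)) := by
    refine Summable.of_nonneg_of_le
      (fun n ↦ mul_nonneg (ha0 n) (le_min zero_le_one (by positivity))) (fun n ↦ ?_) ha
    exact mul_le_of_le_one_right (ha0 n) (min_le_left _ _)
  rw [← (hs θ).tsum_sub (hs θ'), ← tsum_mul_left]
  refine tsum_of_norm_bounded (hsum.mul_left _).hasSum fun n ↦ ?_
  rw [← mul_sub, norm_mul]
  calc _ ≤ a n * (2 * Real.pi * min 1 (|h| * (1 + |(n : ℝ)|))) := by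
        gcongr
        · exact ha0 n
        · exact hc n
        · exact norm_exp_two_pi_I_mul_sub_le (hθ n)
    _ = _ := by ring

theorem zak_eq_tsum_add (f : ℝ → ℂ) (x y : ℝ) :
    zak f x y = ∑' n : ℤ, f (x + n) * Complex.exp (2 * Real.pi * Complex.I * (-(n * y) : ℝ)) := by
  rw [zak, ← (Equiv.neg ℤ).tsum_eq]
  refine tsum_congr fun n ↦ ?_
  simp only [Equiv.neg_apply]
  congr 2
  · push_cast; ring
  · push_cast; ring

theorem WienerBounded.summable_zak {f : ℝ → ℂ} (hf : WienerBounded f) (x y : ℝ) :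
    Summable fun k : ℤ => f (x - k) * Complex.exp (2 * Real.pi * Complex.I * k * y) := by
  obtain ⟨a, ha, hle⟩ := hf |x|
  refine Summable.of_norm_bounded ((Equiv.neg ℤ).summable_iff.2 ha) fun k ↦ ?_
  have := norm_exp_two_pi_I_mul (k * y)
  push_cast at this
  rw [norm_mul, mul_assoc _ (k : ℂ), this, mul_one]
  refine hle _ _ ?_
  simp

theorem WienerBounded.continuous_zak {f : ℝ → ℂ} (hfc : Continuous f) (hf : WienerBounded f) :
    Continuous fun p : ℝ × ℝ => zak f p.1 p.2 := by
  rw [continuous_iff_continuousAt]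
  intro p
  -- The extra `1` makes a single majorant valid on an open strip around `p`, giving locally uniform
  -- convergence.
  obtain ⟨a, ha, hle⟩ := hf (|p.1| + 1)
  have hU : IsOpen {q : ℝ × ℝ | |q.1| < |p.1| + 1} := isOpen_lt (by fun_prop) (by fun_prop)
  simp only [zak_eq_tsum_add]
  refine ContinuousOn.continuousAt (s := {q : ℝ × ℝ | |q.1| < |p.1| + 1}) ?_
    (hU.mem_nhds (by simp))
  refine continuousOn_tsum (fun n ↦ Continuous.continuousOn (by fun_prop)) ha fun n q hq ↦ ?_
  rw [norm_mul, norm_exp_two_pi_I_mul, mul_one]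
  refine hle _ _ ?_
  simpa using le_of_lt hq

theorem fourier_mul_exp (f : ℝ → ℂ) (y w : ℝ) :
    𝓕 (fun t : ℝ => f t * Complex.exp (2 * Real.pi * Complex.I * (-(t * y) : ℝ))) w =
      𝓕 f (y + w) := by
  rw [Real.fourier_real_eq_integral_exp_smul, Real.fourier_real_eq_integral_exp_smul]
  refine integral_congr_ae (Filter.Eventually.of_forall fun t ↦ ?_)
  simp only [smul_eq_mul]
  rw [mul_left_comm, ← Complex.exp_add, mul_comm]
  congr 2
  push_cast
  ring

/-- The Zak transform in terms of the Fourier transform, from Poisson summation. -/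
theorem zak_eq_tsum_fourier {f : ℝ → ℂ} (hfc : Continuous f) (hf : WienerBounded f)
    (hF : WienerBounded (𝓕 f)) (x y : ℝ) :
    zak f x y = ∑' n : ℤ, 𝓕 f (y + n) * Complex.exp (2 * Real.pi * Complex.I * (x * (y + n) : ℝ)) := by
  -- Modulating `f` by `-y` shifts its Fourier transform by `y`, so Poisson summation for `G` at `x`
  -- yields the formula up to the phase `e^{2πixy}`.
  let G : C(ℝ, ℂ) := ⟨fun t => f t * Complex.exp (2 * Real.pi * Complex.I * (-(t * y) : ℝ)),
    by fun_prop⟩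
  have hG (t : ℝ) : ‖G t‖ = ‖f t‖ := by
    simp only [G, ContinuousMap.coe_mk]
    rw [norm_mul, norm_exp_two_pi_I_mul, mul_one]
  have hFG (w : ℝ) : 𝓕 (G : ℝ → ℂ) w = 𝓕 f (y + w) := fourier_mul_exp f y w
  have h1 : ∀ K : TopologicalSpace.Compacts ℝ,
      Summable fun n : ℤ => ‖(G.comp <| ContinuousMap.addRight (n : ℝ)).restrict K‖ := by
    intro K
    obtain ⟨R, hR⟩ := K.isCompact.isBounded.subset_closedBall 0
    -- A nonnegative radius makes the point `n` itself admissible, whence `0 ≤ a n`.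
    obtain ⟨a, ha, hle⟩ := hf (max R 0)
    refine Summable.of_nonneg_of_le (fun n ↦ norm_nonneg _) (fun n ↦ ?_) ha
    have ha0 : 0 ≤ a n := (norm_nonneg _).trans (hle n n (by simp))
    rw [ContinuousMap.norm_le _ ha0]
    intro t
    simp only [ContinuousMap.restrict_apply, ContinuousMap.comp_apply, ContinuousMap.coe_addRight, hG]
    refine hle _ _ ?_
    have := hR t.2
    rw [mem_closedBall_zero_iff, Real.norm_eq_abs] at this
    simpa using Or.inl this
  have h2 : Summable fun n : ℤ => 𝓕 (G : ℝ → ℂ) n := by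
    obtain ⟨b, hb, hle⟩ := hF |y|
    refine Summable.of_norm_bounded hb fun n ↦ ?_
    rw [hFG]
    exact hle _ _ (by simp)
  have h := Real.tsum_eq_tsum_fourier h1 h2 x
  have e : ∀ t : ℝ, Complex.exp (2 * Real.pi * Complex.I * (x * y : ℝ)) *
      Complex.exp (2 * Real.pi * Complex.I * t) =
      Complex.exp (2 * Real.pi * Complex.I * (x * y + t : ℝ)) := fun t ↦ by
    rw [← Complex.exp_add]; congr 1; push_cast; ring
  calc zak f x y = Complex.exp (2 * Real.pi * Complex.I * (x * y : ℝ)) * ∑' n : ℤ, G (x + n) := by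
        rw [zak_eq_tsum_add, ← tsum_mul_left]
        refine tsum_congr fun n ↦ ?_
        simp only [G, ContinuousMap.coe_mk]
        rw [mul_left_comm, e]
        congr 4
        ring
    _ = _ := by
        rw [h, ← tsum_mul_left]
        refine tsum_congr fun n ↦ ?_
        rw [hFG, fourier_coe_apply, mul_left_comm, ← Complex.exp_add]
        congr 2
        push_cast
        ring

/-- Shifting the summation index by `⌊y⌋` keeps the `n`-th frequency within distance `1` of `n`, so
one majorant works for all `y`. -/
theorem zak_eq_tsum_fourier_fract {f : ℝ → ℂ} (hfc : Continuous f) (hf : WienerBounded f)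
    (hF : WienerBounded (𝓕 f)) (x y : ℝ) :
    zak f x y = ∑' n : ℤ, 𝓕 f (Int.fract y + n) *
      Complex.exp (2 * Real.pi * Complex.I * (x * (Int.fract y + n) : ℝ)) := by
  rw [zak_eq_tsum_fourier hfc hf hF, ← (Equiv.subRight ⌊y⌋).tsum_eq]
  refine tsum_congr fun n ↦ ?_
  have : y + ((n - ⌊y⌋ : ℤ) : ℝ) = Int.fract y + n := by
    rw [Int.fract]; push_cast; ring
  simp only [Equiv.subRight_apply, this]

theorem norm_zak_sub_le_right {f : ℝ → ℂ} {R : ℝ} {a : ℤ → ℝ} (ha : Summable a)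
    (hle : ∀ (n : ℤ) (x : ℝ), |x - n| ≤ R → ‖f x‖ ≤ a n) {x : ℝ} (hx : |x| ≤ R) (y b : ℝ) :
    ‖zak f x y - zak f x b‖ ≤
      2 * Real.pi * ∑' n : ℤ, a n * min 1 (|y - b| * (1 + |(n : ℝ)|)) := by
  rw [zak_eq_tsum_add, zak_eq_tsum_add]
  refine norm_tsum_mul_exp_sub_le ha (fun n ↦ hle n _ (by simpa using hx)) fun n ↦ ?_
  rw [show -(n * y) - -(n * b) = -((y - b) * (n : ℝ)) by ring, abs_neg, abs_mul]
  gcongr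
  linarith

/-- On the Fourier side `x` enters only through the phases, as `y` does on the time side. -/
theorem norm_zak_sub_le_left {f : ℝ → ℂ} (hfc : Continuous f) (hf : WienerBounded f)
    (hF : WienerBounded (𝓕 f)) {b : ℤ → ℝ} (hb : Summable b)
    (hle : ∀ (n : ℤ) (x : ℝ), |x - n| ≤ 1 → ‖𝓕 f x‖ ≤ b n) (x a y : ℝ) :
    ‖zak f x y - zak f a y‖ ≤
      2 * Real.pi * ∑' n : ℤ, b n * min 1 (|x - a| * (1 + |(n : ℝ)|)) := by
  have hfr : |Int.fract y| ≤ 1 := by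
    rw [abs_of_nonneg (Int.fract_nonneg y)]
    exact (Int.fract_lt_one y).le
  rw [zak_eq_tsum_fourier_fract hfc hf hF, zak_eq_tsum_fourier_fract hfc hf hF]
  refine norm_tsum_mul_exp_sub_le hb (fun n ↦ hle n _ (by simpa using hfr)) fun n ↦ ?_
  rw [← sub_mul, abs_mul]
  gcongr
  exact (abs_add_le _ _).trans (by gcongr)

/-! ### Weighted `L²` conditions and the continuous representative -/

theorem integrable_one_add_abs_rpow_mul_sq {r : ℝ} (hr : 0 < r) (g : Lp ℂ 2 (volume : Measure ℝ))
    (h : Integrable fun t : ℝ => |t| ^ r * ‖g t‖ ^ 2) :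
    Integrable fun t : ℝ => (1 + |t|) ^ r * ‖g t‖ ^ 2 := by
  have hg := Lp.memLp g
  have hg2 : Integrable fun t : ℝ => ‖g t‖ ^ 2 := hg.integrable_norm_pow (by norm_num)
  refine ((hg2.add h).const_mul (2 ^ r)).mono' ?_ (Filter.Eventually.of_forall fun t ↦ ?_)
  · exact (Measurable.aestronglyMeasurable (by fun_prop)).mul (hg.1.norm.pow 2)
  · rw [Real.norm_of_nonneg (by positivity)]
    have := add_rpow_le_two_rpow_mul zero_le_one (abs_nonneg t) hr.le
    rw [Real.one_rpow] at this
    calc _ ≤ (2 ^ r * (1 + |t| ^ r)) * ‖g t‖ ^ 2 := by gcongr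
      _ = _ := by simp only [Pi.add_apply]; ring

/-- With `w = (1+|t|)^r`, AM–GM gives `2‖g‖ ≤ w⁻¹ + w‖g‖²`, and `w⁻¹` is integrable because `r > 1`.
-/
theorem integrable_of_integrable_weight {r : ℝ} (hr : 1 < r) (g : Lp ℂ 2 (volume : Measure ℝ))
    (h : Integrable fun t : ℝ => (1 + |t|) ^ r * ‖g t‖ ^ 2) : Integrable g := by
  refine ((integrable_one_add_abs_rpow hr).add h).mono' (Lp.memLp g).1
    (Filter.Eventually.of_forall fun t ↦ ?_)
  have hw : 0 < (1 + |t|) ^ r := by positivity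
  simp only [Pi.add_apply]
  rw [Real.rpow_neg (by positivity)]
  set w := (1 + |t|) ^ r
  have h1 : w * w⁻¹ = 1 := mul_inv_cancel₀ hw.ne'
  have h2 : 0 < w⁻¹ := by positivity
  nlinarith [mul_nonneg hw.le (sq_nonneg (‖g t‖ - w⁻¹)), norm_nonneg (g t)]

theorem lintegral_weight_ne_top {r : ℝ} {f : ℝ → ℂ}
    (h : Integrable fun t : ℝ => (1 + |t|) ^ r * ‖f t‖ ^ 2) :
    ∫⁻ t, ENNReal.ofReal ((1 + |t|) ^ r) * ‖f t‖ₑ ^ 2 ≠ ⊤ := by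
  have : ∀ t, ENNReal.ofReal ((1 + |t|) ^ r) * ‖f t‖ₑ ^ 2 =
      ENNReal.ofReal ((1 + |t|) ^ r * ‖f t‖ ^ 2) := fun t ↦ by
    rw [ENNReal.ofReal_mul (by positivity), ENNReal.ofReal_pow (norm_nonneg _), ofReal_norm]
  simp only [this]
  rw [← ofReal_integral_eq_lintegral_ofReal h (Filter.Eventually.of_forall fun t ↦ by positivity)]
  exact ENNReal.ofReal_ne_top

/-- An `L²` function that is integrable together with its Fourier transform has a continuous
representative satisfying the inversion formulas. -/
theorem exists_continuous_representative (g : Lp ℂ 2 (volume : Measure ℝ)) (hg : Integrable g)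
    (hG : Integrable (𝓕 g : Lp ℂ 2 (volume : Measure ℝ))) :
    ∃ f : ℝ → ℂ, Continuous f ∧ f =ᵐ[volume] g ∧
      𝓕 f =ᵐ[volume] (𝓕 g : Lp ℂ 2 (volume : Measure ℝ)) := by
  set G : Lp ℂ 2 (volume : Measure ℝ) := 𝓕 g
  have h1 := Lp.coeFn_fourierInv_of_integrable G hG
  rw [show (𝓕⁻ G : Lp ℂ 2 (volume : Measure ℝ)) = g from FourierTransform.fourierInv_fourier_eq g]
    at h1
  refine ⟨𝓕⁻ (G : ℝ → ℂ), Real.continuous_fourierInv hG, h1.symm, ?_⟩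
  have h2 : 𝓕 (𝓕⁻ (G : ℝ → ℂ)) = 𝓕 (g : ℝ → ℂ) :=
    funext fun ξ ↦ Real.fourier_congr_ae h1.symm ξ
  rw [h2]
  exact (Lp.coeFn_fourier_of_integrable g hg).symm

theorem mainTheorem3 (r s : ℝ) (hr : 0 < r) (hs : 0 < s) (hrs : 1 / r + 1 / s < 1)
    (g : Lp ℂ 2 (volume : Measure ℝ))
    (hfreq : Integrable (fun ξ : ℝ => |ξ| ^ r * ‖(𝓕 g : Lp ℂ 2 (volume : Measure ℝ)) ξ‖ ^ 2))
    (htime : Integrable (fun t : ℝ => |t| ^ s * ‖g t‖ ^ 2)) :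
    ∃ g₀ : ℝ → ℂ, Continuous g₀ ∧ g₀ =ᵐ[volume] g ∧
      (∀ x y : ℝ, Summable fun k : ℤ =>
        g₀ (x - k) * Complex.exp (2 * Real.pi * Complex.I * k * y)) ∧
      Continuous (fun p : ℝ × ℝ => zak g₀ p.1 p.2) ∧
      ∀ a b : ℝ, ∃ C : ℝ, 0 < C ∧ ∀ x y : ℝ,
        ‖zak g₀ x y - zak g₀ a b‖ ^ 2 ≤ C * (zakModulus r s (x - a) + zakModulus s r (y - b)) := by
  have hr1 : 1 < r := by
    have : 0 < 1 / s := by positivity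
    exact (one_div_lt_one_div hr one_pos).1 (by rw [one_div_one]; linarith)
  have hs1 : 1 < s := by
    have : 0 < 1 / r := by positivity
    exact (one_div_lt_one_div hs one_pos).1 (by rw [one_div_one]; linarith)
  have hw := integrable_one_add_abs_rpow_mul_sq hs g htime
  have hW := integrable_one_add_abs_rpow_mul_sq hr _ hfreq
  have hgi := integrable_of_integrable_weight hs1 g hw
  have hGi := integrable_of_integrable_weight hr1 _ hW
  obtain ⟨f, hfc, hfg, hFG⟩ := exists_continuous_representative g hgi hGi
  have hf : Integrable f := hgi.congr hfg.symm
  have hF : Integrable (𝓕 f) := hGi.congr hFG.symm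
  have hf2 : MemLp f 2 := (memLp_congr_ae hfg).2 (Lp.memLp g)
  have hF2 : MemLp (𝓕 f) 2 := (memLp_congr_ae hFG).2 (Lp.memLp _)
  have hwf : ∫⁻ t, ENNReal.ofReal ((1 + |t|) ^ s) * ‖f t‖ₑ ^ 2 ≠ ⊤ :=
    lintegral_weight_ne_top (hw.congr (hfg.mono fun t ht ↦ by simp only [ht]))
  have hWF : ∫⁻ t, ENNReal.ofReal ((1 + |t|) ^ r) * ‖𝓕 f t‖ₑ ^ 2 ≠ ⊤ :=
    lintegral_weight_ne_top (hW.congr (hFG.mono fun t ht ↦ by simp only [ht]))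
  -- This reflection transfers the time hypotheses on `f` to the frequency side of `𝓕 f`, so the
  -- majorant also applies to `𝓕 f` with `r` and `s` swapped.
  have hFFf : 𝓕 (𝓕 f) = fun x ↦ f (-x) := by
    funext x
    conv_rhs => rw [← hfc.fourierInv_fourier_eq hf hF, Real.fourierInv_eq_fourier_neg, neg_neg]
  have hFF2 : MemLp (𝓕 (𝓕 f)) 2 := by
    rw [hFFf]
    exact hf2.comp_measurePreserving (Measure.measurePreserving_neg volume)
  have hwFF : ∫⁻ t, ENNReal.ofReal ((1 + |t|) ^ s) * ‖𝓕 (𝓕 f) t‖ₑ ^ 2 ≠ ⊤ := by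
    rw [hFFf, ← lintegral_neg_eq_self]
    simpa using hwf
  have maj := exists_summable_majorant hr hs hrs hfc hf hf2 hF hF2 hwf hWF
  have majF := exists_summable_majorant hs hr (by linarith) (Real.continuous_fourier hf) hF hF2
    (by rw [hFFf]; exact hf.comp_neg) hFF2 hWF hwFF
  have hfW : WienerBounded f := fun R ↦ by
    obtain ⟨a, -, -, ha, -, hle, -⟩ := maj R
    exact ⟨a, ha, hle⟩
  have hFW : WienerBounded (𝓕 f) := fun R ↦ by
    obtain ⟨a, -, -, ha, -, hle, -⟩ := majF R
    exact ⟨a, ha, hle⟩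
  refine ⟨f, hfc, hfg, hfW.summable_zak, hfW.continuous_zak hfc, fun a b ↦ ?_⟩
  -- The path runs through `(a, y)`. The `y`-step takes place at `x = a`, so radius `|a|` suffices;
  -- the `x`-step uses fractional parts, so radius `1` suffices for every `y`.
  obtain ⟨u, C₁, -, hu, hC₁, hule, hub⟩ := maj |a|
  obtain ⟨v, C₂, -, hv, hC₂, hvle, hvb⟩ := majF 1
  refine ⟨8 * Real.pi ^ 2 * (C₁ + C₂) + 1, by positivity, fun x y ↦ ?_⟩
  have h1 := norm_zak_sub_le_left hfc hfW hFW hv hvle x a y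
  have h2 := norm_zak_sub_le_right hu hule le_rfl y b
  have h1' := hvb (x - a)
  have h2' := hub (y - b)
  set S := ∑' n : ℤ, v n * min 1 (|x - a| * (1 + |(n : ℝ)|))
  set T := ∑' n : ℤ, u n * min 1 (|y - b| * (1 + |(n : ℝ)|))
  have hφ := zakModulus_nonneg (r := r) (s := s) (x - a)
  have hψ := zakModulus_nonneg (r := s) (s := r) (y - b)
  set φ := zakModulus r s (x - a)
  set ψ := zakModulus s r (y - b)
  have htri : ‖zak f x y - zak f a b‖ ≤ 2 * Real.pi * S + 2 * Real.pi * T :=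
    (norm_sub_le_norm_sub_add_norm_sub _ (zak f a y) _).trans (add_le_add h1 h2)
  calc ‖zak f x y - zak f a b‖ ^ 2 ≤ (2 * Real.pi * S + 2 * Real.pi * T) ^ 2 := by gcongr
    _ ≤ 8 * Real.pi ^ 2 * (S ^ 2 + T ^ 2) := by
        nlinarith [mul_nonneg (sq_nonneg Real.pi) (sq_nonneg (S - T))]
    _ ≤ 8 * Real.pi ^ 2 * (C₂ * φ + C₁ * ψ) := by gcongr
    _ ≤ 8 * Real.pi ^ 2 * ((C₁ + C₂) * (φ + ψ)) := by
        gcongr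
        nlinarith [mul_nonneg hC₁ hφ, mul_nonneg hC₂ hψ]
    _ ≤ _ := by
        rw [add_mul, mul_assoc]
        linarith
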